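/- Let $X$ be a real Banach space with dual $X^*$ (with the dual norm), and let $f:X\to\mathbb{R}$ be lower semicontinuous and bounded below. Write $\inf f=\inf_{x\in X}f(x)$ and $\operatorname{Argmin} f=\{x\in X: f(x)=\inf f\}$, and use $\operatorname{dist}(\cdot,\varnothing)=+\infty$. Suppose that $f$ is quasidifferentiable at every $x\in X$: the one-sided directional derivative $f'(x;v)=\lim_{t\downarrow 0}\frac{f(x+tv)-f(x)}{t}$ exists for every $v\in X$, and $f'(x;\cdot)$ is a difference of two continuous sublinear functions on $X$. Equivalently, there are nonempty, convex, weak-$*$ compact sets $A,B\subseteq X^*$ with $f'(x;v)=s_A(v)-s_B(v)$ for all $v\in X$, where $s_A(v)=\max_{\xi\in A}\langle\xi,v\rangle$; such a pair is denoted $(\underline{\partial}f(x),-\overline{\partial}f(x))$. For nonempty, convex, weak-$*$ compact $A,B\subseteq X^*$ let the Demyanov difference $A\mathbin{\dot-}B$ be the Clarke subdifferential of $s_A-s_B$ at $0$, where the Clarke subdifferential of a locally Lipschitz function $\varphi$ at $x$ is $$\Big\{\xi\in X^*:\ \langle\xi,v\rangle\le\limsup_{y\to x,\ t\downarrow0}\frac{\varphi(y+tv)-\varphi(y)}{t}\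 \text{ for all } v\in X\Big\}.$$ Put $D f(x)=\underline{\partial}f(x)\mathbin{\dot-}(-\overline{\partial}f(x))$, a set which does not depend on the chosen pair. Let $\tau\in(0,+\infty]$ and suppose that $$\operatorname{dist}\Big(0,\bigcup_{x\in X\setminus\operatorname{Argmin} f}D f(x)\Big)=\tau .$$ Then $f$ has global weak sharp minimizers, that is, $\operatorname{Argmin} f\ne\varnothing$ and there is $\sigma>0$ with $$\sigma\,\operatorname{dist}(x,\operatorname{Argmin} f)\le f(x)-\inf f\quad\text{for all }x\in X,$$ and the supremum of all such $\sigma>0$ is at least $\tau$. -/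

import Mathlib

open Filter Topology
open scoped ENNReal

noncomputable section

namespace WeakSharp

section Metric

variable {M : Type*} [MetricSpace M]

/-- The set of global minimizers of `f`. -/
def Argmin (f : M → ℝ) : Set M := {x | ∀ y, f x ≤ f y}

/-- `σ · dist (x, Argmin f) ≤ f x - inf f` for every `x`. The distance to a set is the
extended one (`+∞` for the empty set), and `inf f` is the real infimum, used for functions
bounded below. -/
def IsSharpConst (f : M → ℝ) (σ : ℝ) : Prop :=
  ∀ x, ENNReal.ofReal σ * Metric.infEDist x (Argmin f) ≤ ENNReal.ofReal (f x - ⨅ y, f y)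

/-- `f` has global weak sharp minimizers. -/
def HasGlobalWeakSharpMinimizers (f : M → ℝ) : Prop :=
  (Argmin f).Nonempty ∧ ∃ σ : ℝ, 0 < σ ∧ IsSharpConst f σ

/-- The modulus of global weak sharpness: the supremum, in `[0, +∞]`, of all `σ > 0`
satisfying the weak sharpness inequality. -/
def weakSharpModulus (f : M → ℝ) : ℝ≥0∞ :=
  ⨆ (σ : ℝ) (_ : 0 < σ) (_ : IsSharpConst f σ), ENNReal.ofReal σ

end Metric

section Normed

variable {X : Type*} [NormedAddCommGroup X] [NormedSpace ℝ X]

/-- The one-sided directional derivative `f'(x; v)` exists and equals the real number `L`. -/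
def HasDirDerivAt (f : X → ℝ) (x v : X) (L : ℝ) : Prop :=
  Tendsto (fun t : ℝ => (f (x + t • v) - f x) / t) (𝓝[>] 0) (𝓝 L)

/-- Continuous sublinear functions. -/
structure IsContSublinear (p : X → ℝ) : Prop where
  continuous : Continuous p
  pos_hom : ∀ (t : ℝ) (v : X), 0 ≤ t → p (t • v) = t * p v
  subadd : ∀ u v : X, p (u + v) ≤ p u + p v

/-- `f` is quasidifferentiable at `x`: it is directionally differentiable at `x` in all
directions, and `f'(x; ·)` is a difference of two continuous sublinear functions. -/
def QuasidifferentiableAt (f : X → ℝ) (x : X) : Prop :=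
  ∃ p q : X → ℝ, IsContSublinear p ∧ IsContSublinear q ∧
    ∀ v, HasDirDerivAt f x v (p v - q v)

/-- Nonempty convex weak-* compact subsets of the dual space. -/
structure IsConvWeakStarCompact (A : Set (StrongDual ℝ X)) : Prop where
  nonempty : A.Nonempty
  convex : Convex ℝ A
  compact : IsCompact (StrongDual.toWeakDual '' A)

/-- The support function of a subset of the dual space. -/
def supportFun (A : Set (StrongDual ℝ X)) (v : X) : ℝ :=
  sSup ((fun ξ : StrongDual ℝ X => ξ v) '' A)

/-- The Clarke generalized directional derivative
`limsup_{y → x, t ↓ 0} (φ (y + t v) - φ y) / t`, as an extended real number. -/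
def clarkeDirDeriv (φ : X → ℝ) (x v : X) : EReal :=
  limsup (fun z : X × ℝ => (((φ (z.1 + z.2 • v) - φ z.1) / z.2 : ℝ) : EReal))
    (𝓝 x ×ˢ 𝓝[>] (0 : ℝ))

/-- The Clarke subdifferential. -/
def clarkeSubdiff (φ : X → ℝ) (x : X) : Set (StrongDual ℝ X) :=
  {ξ | ∀ v, ((ξ v : ℝ) : EReal) ≤ clarkeDirDeriv φ x v}

/-- The Demyanov difference of `A` and `B`. -/
def demyanovDiff (A B : Set (StrongDual ℝ X)) : Set (StrongDual ℝ X) :=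
  clarkeSubdiff (fun v => supportFun A v - supportFun B v) 0

/-- The quasidifferential of `f` at `x`: all pairs `(A, B)` of nonempty convex weak-* compact
sets with `f'(x; v) = supportFun A v - supportFun B v` for all `v`. In the usual notation
`A` is the lower part and `B` is minus the upper part. These pairs form one class for the
relation `(A, B) ∼ (C, D) ↔ A + D = B + C`. -/
def quasidifferential (f : X → ℝ) (x : X) :
    Set (Set (StrongDual ℝ X) × Set (StrongDual ℝ X)) :=
  {P | IsConvWeakStarCompact P.1 ∧ IsConvWeakStarCompact P.2 ∧
    ∀ v, HasDirDerivAt f x v (supportFun P.1 v - supportFun P.2 v)}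

/-- The Demyanov difference `A ∸ B` of the quasidifferential pairs `(A, B)` of `f` at `x`. It
is the same for all of them, see `demyanovSubdiff_eq`, so that the union is that of a single
set. -/
def demyanovSubdiff (f : X → ℝ) (x : X) : Set (StrongDual ℝ X) :=
  ⋃ P ∈ quasidifferential f x, demyanovDiff P.1 P.2

theorem demyanovSubdiff_eq {f : X → ℝ} {x : X}
    {P : Set (StrongDual ℝ X) × Set (StrongDual ℝ X)} (hP : P ∈ quasidifferential f x) :
    demyanovSubdiff f x = demyanovDiff P.1 P.2 := by
  have key : ∀ Q ∈ quasidifferential f x,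
      demyanovDiff Q.1 Q.2 = demyanovDiff P.1 P.2 := by
    intro Q hQ
    have h : (fun v => supportFun Q.1 v - supportFun Q.2 v) =
        fun v => supportFun P.1 v - supportFun P.2 v :=
      funext fun v => tendsto_nhds_unique (hQ.2.2 v) (hP.2.2 v)
    unfold demyanovDiff
    rw [h]
  ext ξ
  simp only [demyanovSubdiff, Set.mem_iUnion]
  constructor
  · rintro ⟨Q, hQ, h⟩
    exact key Q hQ ▸ h
  · intro h
    exact ⟨P, hP, h⟩

end Normed

end WeakSharp

end

open Filter Topology
open scoped ENNReal

namespace WeakSharp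

/-! Fix `0 < σ < τ` and a start `x₀`. Ekeland's principle gives `x` with `f x + σ * dist x₀ x ≤ f
x₀` that minimizes `f + σ * dist x ·`; hence `f'(x; v) ≥ -σ‖v‖` for all `v`. Write `f'(x; ·) = φ = p
- q`. Homogeneity of `φ` makes its Clarke derivative at `0` dominate the sublinear function `g v =
sup_z (φ (z + v) - φ z)`, and `g ≥ φ ≥ -σ‖·‖`. A Hahn–Banach sandwich then yields a functional below
both `g` and `σ‖·‖`: an element of `D f x` of norm at most `σ` (`exists_mem_clarkeSubdiff_norm_le`).
As `σ < τ`, this forces `x` to be a minimizer, and the Ekeland inequality is weak sharpness with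
constant `σ`. Let `σ` increase to `τ`. -/

/-- A form of Ekeland's variational principle. -/
theorem exists_ekeland_point {M : Type*} [MetricSpace M] [CompleteSpace M] {f : M → ℝ}
    (hlsc : LowerSemicontinuous f) (hbdd : BddBelow (Set.range f)) {σ : ℝ} (hσ : 0 < σ)
    (x₀ : M) :
    ∃ x, f x + σ * dist x₀ x ≤ f x₀ ∧ ∀ z, f x ≤ f z + σ * dist x z := by
  let S : M → Set M := fun x => {y | f y + σ * dist x y ≤ f x}
  have hself : ∀ x, x ∈ S x := fun x => by simp [S]
  have htrans : ∀ {x y z}, y ∈ S x → z ∈ S y → z ∈ S x := by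
    intro x y z hy hz
    simp only [S, Set.mem_ofPred_eq] at *
    have := mul_le_mul_of_nonneg_left (dist_triangle x y z) hσ.le
    linarith
  have hmono : ∀ {x y}, y ∈ S x → f y ≤ f x := by
    intro x y hy
    simp only [S, Set.mem_ofPred_eq] at hy
    have : 0 ≤ σ * dist x y := by positivity
    linarith
  have hclosed : ∀ x, IsClosed (S x) := by
    intro x
    have : LowerSemicontinuous fun y => f y + σ * dist x y :=
      hlsc.add (Continuous.lowerSemicontinuous (by fun_prop))
    exact this.isClosed_preimage (f x)
  -- Moving to `y` at least halves the gap between `f x` and the infimum of `f` over `S x`.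
  have hnext : ∀ x, ∃ y ∈ S x, ∀ z ∈ S x, 2 * f y ≤ f x + f z := by
    intro x
    have hb : BddBelow (f '' S x) := hbdd.mono (Set.image_subset_range _ _)
    have hle : ∀ z ∈ S x, sInf (f '' S x) ≤ f z := fun z hz =>
      csInf_le hb (Set.mem_image_of_mem f hz)
    rcases (hle x (hself x)).eq_or_lt with h | h
    · exact ⟨x, hself x, fun z hz => by linarith [hle z hz]⟩
    · obtain ⟨_, ⟨y, hy, rfl⟩, hlt⟩ := exists_lt_of_csInf_lt
        (Set.Nonempty.image f ⟨x, hself x⟩)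
        (show sInf (f '' S x) < (f x + sInf (f '' S x)) / 2 by linarith)
      exact ⟨y, hy, fun z hz => by linarith [hle z hz]⟩
  choose next hnextS hnext using hnext
  let u : ℕ → M := fun n => next^[n] x₀
  have hu : ∀ n, u (n + 1) = next (u n) := fun n => Function.iterate_succ_apply' next n x₀
  have huS : ∀ n m, n ≤ m → u m ∈ S (u n) := by
    intro n m h
    induction m, h using Nat.le_induction with
    | base => exact hself _
    | succ m _ ih => exact htrans ih (hu m ▸ hnextS (u m))
  have hanti : Antitone fun n => f (u n) := fun n m h => hmono (huS n m h)
  obtain ⟨L, hL⟩ : ∃ L, Tendsto (fun n => f (u n)) atTop (𝓝 L) :=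
    ⟨_, tendsto_atTop_ciInf hanti (hbdd.mono (Set.range_comp_subset_range u f))⟩
  have hLle : ∀ n, L ≤ f (u n) := fun n => hanti.le_of_tendsto hL n
  have hcauchy : CauchySeq u := by
    refine cauchySeq_of_le_tendsto_0' (fun n => (f (u n) - L) / σ) (fun n m h => ?_) ?_
    · rw [le_div_iff₀ hσ]
      have := huS n m h
      simp only [S, Set.mem_ofPred_eq] at this
      linarith [hLle m]
    · simpa using (hL.sub_const L).div_const σ
  obtain ⟨x, hx⟩ := cauchySeq_tendsto_of_complete hcauchy
  have hxS : ∀ n, x ∈ S (u n) := fun n =>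
    (hclosed (u n)).mem_of_tendsto hx (eventually_atTop.2 ⟨n, fun m h => huS n m h⟩)
  refine ⟨x, hxS 0, fun z => ?_⟩
  -- A violating `z` lies in every `S (u n)`, so halving passes to the limit as `L ≤ f z`, against
  -- `f z < f x ≤ L`.
  by_contra! hz
  have hzS : z ∈ S x := hz.le
  have hLz : 2 * L ≤ L + f z :=
    le_of_tendsto_of_tendsto' ((hL.comp (tendsto_add_atTop_nat 1)).const_mul 2)
      (hL.add_const (f z)) fun n => by
        simpa only [Function.comp_apply, hu] using hnext (u n) z (htrans (hxS n) hzS)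
  have hxL : f x ≤ L := ge_of_tendsto' hL fun n => hmono (hxS n)
  have : 0 ≤ σ * dist x z := by positivity
  linarith

theorem isSharpConst_of_exists_mem_Argmin {M : Type*} [MetricSpace M] {f : M → ℝ} {σ : ℝ}
    (hσ : 0 < σ) (h : ∀ x₀, ∃ x ∈ Argmin f, f x + σ * dist x₀ x ≤ f x₀) : IsSharpConst f σ := by
  intro x₀
  obtain ⟨x, hxA, hx⟩ := h x₀
  have : Nonempty M := ⟨x⟩
  have hinf : ⨅ y, f y = f x :=
    le_antisymm (ciInf_le ⟨f x, Set.forall_mem_range.2 hxA⟩ x) (le_ciInf hxA)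
  calc ENNReal.ofReal σ * Metric.infEDist x₀ (Argmin f)
      ≤ ENNReal.ofReal σ * edist x₀ x := by
        gcongr
        exact Metric.infEDist_le_edist_of_mem hxA
    _ = ENNReal.ofReal (σ * dist x₀ x) := by rw [edist_dist, ENNReal.ofReal_mul hσ.le]
    _ ≤ ENNReal.ofReal (f x₀ - ⨅ y, f y) := ENNReal.ofReal_le_ofReal (by rw [hinf]; linarith)

section Normed

variable {X : Type*} [NormedAddCommGroup X] [NormedSpace ℝ X]

/-! ### Continuous sublinear functions as support functions -/

namespace IsContSublinear

variable {p : X → ℝ}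

theorem map_zero (hp : IsContSublinear p) : p 0 = 0 := by
  simpa using hp.pos_hom 0 0 le_rfl

theorem exists_bound (hp : IsContSublinear p) : ∃ K : ℝ, 0 ≤ K ∧ ∀ v, p v ≤ K * ‖v‖ := by
  obtain ⟨δ, hδ, h⟩ := Metric.continuousAt_iff.1 (hp.continuous.continuousAt (x := 0)) 1
    one_pos
  -- Rescale `v` to norm `δ / 2`, inside the ball where `|p| < 1`.
  refine ⟨2 / δ, by positivity, fun v => ?_⟩
  rcases eq_or_ne v 0 with rfl | hv
  · simp [hp.map_zero]
  have hv' : 0 < ‖v‖ := norm_pos_iff.2 hv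
  have hc : 0 < δ / 2 / ‖v‖ := by positivity
  have hlt := h (x := (δ / 2 / ‖v‖) • v) (by
    rw [dist_zero_right, norm_smul, Real.norm_of_nonneg hc.le, div_mul_cancel₀ _ hv'.ne']
    linarith)
  rw [hp.map_zero, dist_zero_right, hp.pos_hom _ _ hc.le] at hlt
  have h1 : δ / 2 / ‖v‖ * p v < 1 := (le_abs_self _).trans_lt hlt
  have h2 : p v < 1 / (δ / 2 / ‖v‖) := by rwa [lt_div_iff₀' hc]
  refine h2.le.trans_eq ?_
  field_simp

end IsContSublinear

/-- A linear functional dominated by a multiple of the norm is continuous. -/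
theorem exists_strongDual_of_le {p : X → ℝ} {K : ℝ} (hK : ∀ v, p v ≤ K * ‖v‖)
    (g : X →ₗ[ℝ] ℝ) (hg : ∀ v, g v ≤ p v) : ∃ ξ : StrongDual ℝ X, ∀ v, ξ v = g v := by
  refine ⟨g.mkContinuous K fun v => ?_, fun v => rfl⟩
  rw [Real.norm_eq_abs, abs_le]
  have h1 := (hg v).trans (hK v)
  have h2 := (hg (-v)).trans (hK (-v))
  rw [g.map_neg, norm_neg] at h2
  exact ⟨by linarith, h1⟩

/-- Hahn–Banach, extending `c • v ↦ c * p v` from the line through `v`. For `c < 0` the domination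
follows from `0 = p 0 ≤ p (c • v) + p (-c • v)`. -/
theorem IsContSublinear.exists_le_apply_eq {p : X → ℝ} (hp : IsContSublinear p) (v : X) :
    ∃ ξ : StrongDual ℝ X, (∀ w, ξ w ≤ p w) ∧ ξ v = p v := by
  obtain ⟨K, -, hK⟩ := hp.exists_bound
  have H : ∀ c : ℝ, c • v = 0 → (RingHom.id ℝ) c • p v = 0 := by
    intro c hc
    rcases smul_eq_zero.1 hc with rfl | rfl
    · simp
    · simp [hp.map_zero]
  obtain ⟨g, hg, hgp⟩ := exists_extension_of_le_sublinear
    (LinearPMap.mkSpanSingleton' v (p v) H) p (fun c hc x => hp.pos_hom c x hc.le) hp.subadd (by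
      rintro ⟨x, hx⟩
      obtain ⟨c, rfl⟩ := Submodule.mem_span_singleton.1 hx
      rw [LinearPMap.mkSpanSingleton'_apply]
      simp only [RingHom.id_apply, smul_eq_mul]
      rcases le_total 0 c with hc | hc
      · exact (hp.pos_hom c v hc).ge
      · have h1 := hp.pos_hom (-c) v (by linarith)
        have h2 := hp.subadd (c • v) ((-c) • v)
        rw [← add_smul, add_neg_cancel, zero_smul, hp.map_zero] at h2
        linarith)
  obtain ⟨ξ, hξ⟩ := exists_strongDual_of_le hK g hgp
  refine ⟨ξ, fun w => hξ w ▸ hgp w, ?_⟩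
  have hv : v ∈ (LinearPMap.mkSpanSingleton' v (p v) H).domain :=
    Submodule.mem_span_singleton_self v
  rw [hξ, hg ⟨v, hv⟩, LinearPMap.mkSpanSingleton'_apply_self]

/-- The set of continuous linear functionals dominated by `p`. -/
def minorants (p : X → ℝ) : Set (StrongDual ℝ X) := {ξ | ∀ v, ξ v ≤ p v}

theorem IsContSublinear.isConvWeakStarCompact_minorants {p : X → ℝ} (hp : IsContSublinear p) :
    IsConvWeakStarCompact (minorants p) where
  nonempty := (hp.exists_le_apply_eq 0).imp fun _ h => h.1
  convex := by
    intro ξ hξ η hη a b ha hb hab v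
    have h1 := mul_le_mul_of_nonneg_left (hξ v) ha
    have h2 := mul_le_mul_of_nonneg_left (hη v) hb
    calc (a • ξ + b • η) v = a * ξ v + b * η v := rfl
      _ ≤ a * p v + b * p v := add_le_add h1 h2
      _ = p v := by rw [← add_mul, hab, one_mul]
  compact := by
    obtain ⟨K, hK0, hK⟩ := hp.exists_bound
    refine (WeakDual.isCompact_closedBall (𝕜 := ℝ) (0 : StrongDual ℝ X) K).of_isClosed_subset
      ?_ ?_
    · have : StrongDual.toWeakDual '' minorants p = ⋂ v, {ξ : WeakDual ℝ X | ξ v ≤ p v} := by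
        ext ξ
        simp only [Set.mem_image, Set.mem_iInter, Set.mem_ofPred_eq]
        constructor
        · rintro ⟨η, hη, rfl⟩ v
          exact hη v
        · exact fun h => ⟨WeakDual.toStrongDual ξ, h, rfl⟩
      rw [this]
      exact isClosed_iInter fun v => isClosed_le (WeakDual.eval_continuous v) continuous_const
    · rintro _ ⟨ξ, hξ, rfl⟩
      have : ‖ξ‖ ≤ K := by
        refine ξ.opNorm_le_bound hK0 fun v => ?_
        rw [Real.norm_eq_abs, abs_le]
        have h1 := (hξ v).trans (hK v)
        have h2 := (hξ (-v)).trans (hK (-v))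
        rw [map_neg, norm_neg] at h2
        exact ⟨by linarith, h1⟩
      simpa using this

theorem IsContSublinear.supportFun_minorants {p : X → ℝ} (hp : IsContSublinear p) (v : X) :
    supportFun (minorants p) v = p v := by
  obtain ⟨ξ, hξ, hξv⟩ := hp.exists_le_apply_eq v
  refine IsGreatest.csSup_eq ⟨⟨ξ, hξ, hξv⟩, ?_⟩
  rintro _ ⟨η, hη, rfl⟩
  exact hη v

/-- The sets of minorants of `p` and `q` form a quasidifferential pair with support functions `p`
and `q`, so the Demyanov difference can be read off from `p - q` directly. -/
theorem demyanovSubdiff_eq_clarkeSubdiff {f : X → ℝ} {x : X} {p q : X → ℝ}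
    (hp : IsContSublinear p) (hq : IsContSublinear q)
    (h : ∀ v, HasDirDerivAt f x v (p v - q v)) :
    demyanovSubdiff f x = clarkeSubdiff (fun v => p v - q v) 0 := by
  have hP : (minorants p, minorants q) ∈ quasidifferential f x :=
    ⟨hp.isConvWeakStarCompact_minorants, hq.isConvWeakStarCompact_minorants, fun v => by
      simpa only [hp.supportFun_minorants, hq.supportFun_minorants] using h v⟩
  rw [demyanovSubdiff_eq hP, demyanovDiff]
  simp only [hp.supportFun_minorants, hq.supportFun_minorants]

/-! ### Small elements of the Clarke subdifferential -/

/-- Increments of a positively homogeneous function are bounded by its Clarke derivative at the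
origin. -/
theorem sub_le_clarkeDirDeriv_zero {φ : X → ℝ}
    (hφ : ∀ (t : ℝ) (v : X), 0 ≤ t → φ (t • v) = t * φ v) (z v : X) :
    ((φ (z + v) - φ z : ℝ) : EReal) ≤ clarkeDirDeriv φ 0 v := by
  -- Along the base points `t • z` the difference quotient is constant in `t`, which bounds the
  -- limsup from below.
  have ht : Tendsto (fun t : ℝ => (t • z, t)) (𝓝[>] 0) (𝓝 (0 : X) ×ˢ 𝓝[>] (0 : ℝ)) := by
    refine Tendsto.prodMk ?_ tendsto_id
    have : Tendsto (fun t : ℝ => t • z) (𝓝 0) (𝓝 ((0 : ℝ) • z)) :=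
      (continuous_id.smul continuous_const).tendsto 0
    rw [zero_smul] at this
    exact this.mono_left nhdsWithin_le_nhds
  refine le_limsup_of_frequently_le (ht.frequently (Eventually.frequently ?_))
  filter_upwards [self_mem_nhdsWithin] with t (h0 : 0 < t)
  rw [← smul_add, hφ t _ h0.le, hφ t _ h0.le, ← mul_sub, mul_div_cancel_left₀ _ h0.ne']

/-- If `p - q ≥ -σ ‖·‖` for continuous sublinear functions `p`, `q`, the Clarke subdifferential
of `p - q` at the origin meets the ball of radius `σ`. -/
theorem exists_mem_clarkeSubdiff_norm_le {p q : X → ℝ} (hp : IsContSublinear p)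
    (hq : IsContSublinear q) {σ : ℝ} (hσ : 0 ≤ σ) (h : ∀ v, -(σ * ‖v‖) ≤ p v - q v) :
    ∃ ξ ∈ clarkeSubdiff (fun v => p v - q v) 0, ‖ξ‖ ≤ σ := by
  set φ : X → ℝ := fun v => p v - q v with hφdef
  have hφ : ∀ (t : ℝ) (v : X), 0 ≤ t → φ (t • v) = t * φ v := fun t v ht => by
    simp only [hφdef, hp.pos_hom t v ht, hq.pos_hom t v ht]; ring
  have hφ0 : φ 0 = 0 := by simp [hφdef, hp.map_zero, hq.map_zero]
  -- the inf-convolution of the sublinear majorant of increments with `σ ‖·‖`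
  let g : X → ℝ := fun v => ⨆ z, (φ (z + v) - φ z)
  have hgb : ∀ v, BddAbove (Set.range fun z => φ (z + v) - φ z) := by
    intro v
    refine ⟨p v + q (-v), ?_⟩
    rintro _ ⟨z, rfl⟩
    have h1 := hp.subadd z v
    have h2 := hq.subadd (z + v) (-v)
    rw [add_neg_cancel_right] at h2
    simp only [hφdef]
    linarith
  have hgle : ∀ v z, φ (z + v) - φ z ≤ g v := fun v z => le_ciSup (hgb v) z
  have hgφ : ∀ v, φ v ≤ g v := fun v => by simpa [hφ0] using hgle v 0
  have hg0 : g 0 = 0 := by simp [g]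
  have hgadd : ∀ u v, g (u + v) ≤ g u + g v := by
    intro u v
    refine ciSup_le fun z => ?_
    have h1 := hgle u z
    have h2 := hgle v (z + u)
    rw [add_assoc] at h2
    linarith
  have hghom : ∀ c : ℝ, 0 < c → ∀ v, g (c • v) ≤ c * g v := by
    intro c hc v
    refine ciSup_le fun z => ?_
    have h1 := mul_le_mul_of_nonneg_left (hgle v (c⁻¹ • z)) hc.le
    rwa [mul_sub, ← hφ _ _ hc.le, ← hφ _ _ hc.le, smul_add, smul_inv_smul₀ hc.ne'] at h1
  let N : X → ℝ := fun v => ⨅ w, (g (v + w) + σ * ‖w‖)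
  have hNb : ∀ v, BddBelow (Set.range fun w => g (v + w) + σ * ‖w‖) := by
    intro v
    refine ⟨-(σ * ‖v‖), ?_⟩
    rintro _ ⟨w, rfl⟩
    have h1 := (h (v + w)).trans (hgφ (v + w))
    have h2 := mul_le_mul_of_nonneg_left (norm_add_le v w) hσ
    simp only
    linarith
  have hNle : ∀ v w, N v ≤ g (v + w) + σ * ‖w‖ := fun v w => ciInf_le (hNb v) w
  have hNadd : ∀ u v, N (u + v) ≤ N u + N v := by
    intro u v
    refine le_ciInf_add_ciInf fun a b => ?_
    have h1 := hNle (u + v) (a + b)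
    have h2 := hgadd (u + a) (v + b)
    have h3 := mul_le_mul_of_nonneg_left (norm_add_le a b) hσ
    rw [add_add_add_comm] at h1
    linarith
  have hNhom' : ∀ c : ℝ, 0 < c → ∀ v, N (c • v) ≤ c * N v := by
    intro c hc v
    rw [← div_le_iff₀' hc]
    refine le_ciInf fun w => ?_
    rw [div_le_iff₀' hc]
    have h1 := hNle (c • v) (c • w)
    rw [← smul_add, norm_smul, Real.norm_of_nonneg hc.le] at h1
    have h2 := hghom c hc (v + w)
    linarith
  have hNhom : ∀ c : ℝ, 0 < c → ∀ v, N (c • v) = c * N v := by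
    intro c hc v
    refine le_antisymm (hNhom' c hc v) ?_
    have h1 := hNhom' c⁻¹ (inv_pos.2 hc) (c • v)
    rw [inv_smul_smul₀ hc.ne'] at h1
    rwa [← le_inv_mul_iff₀ hc]
  have hNσ : ∀ v, N v ≤ σ * ‖v‖ := fun v => by simpa [hg0] using hNle v (-v)
  -- Extending from the zero subspace only requires `0 ≤ N 0`, which is `g w ≥ -σ‖w‖`. The extension
  -- is below `g` and below `σ‖·‖` because `N` is.
  obtain ⟨l, -, hl⟩ := exists_extension_of_le_sublinear ((0 : X →ₗ[ℝ] ℝ).toPMap ⊥) N hNhom hNadd (by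
    rintro ⟨x, hx⟩
    obtain rfl : x = 0 := (Submodule.mem_bot ℝ).1 hx
    have : (0 : ℝ) ≤ N 0 := le_ciInf fun w => by
      have := (h w).trans (hgφ w)
      rw [zero_add]
      linarith
    simpa using this)
  obtain ⟨ξ, hξ⟩ := exists_strongDual_of_le hNσ l hl
  refine ⟨ξ, fun v => ?_, ξ.opNorm_le_bound hσ fun v => ?_⟩
  · have h1 : ξ v ≤ g v := by
      rw [hξ]
      exact (hl v).trans (by simpa using hNle v 0)
    refine (EReal.coe_le_coe_iff.2 h1).trans ?_
    refine le_of_forall_lt fun c hc => ?_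
    induction c with
    | bot => exact (EReal.bot_lt_coe _).trans_le (sub_le_clarkeDirDeriv_zero hφ 0 v)
    | top => exact absurd hc (by simp)
    | coe c =>
      obtain ⟨z, hz⟩ := exists_lt_of_lt_ciSup (EReal.coe_lt_coe_iff.1 hc)
      exact (EReal.coe_lt_coe_iff.2 hz).trans_le (sub_le_clarkeDirDeriv_zero hφ z v)
  · rw [Real.norm_eq_abs, abs_le, hξ]
    have h1 := (hl v).trans (hNσ v)
    have h2 := (hl (-v)).trans (hNσ (-v))
    rw [map_neg, norm_neg] at h2
    exact ⟨by linarith, h1⟩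

/-! ### From Ekeland points to minimizers -/

theorem HasDirDerivAt.neg_le_of_le_add {f : X → ℝ} {x v : X} {L σ : ℝ}
    (hL : HasDirDerivAt f x v L) (h : ∀ z, f x ≤ f z + σ * dist x z) : -(σ * ‖v‖) ≤ L := by
  refine ge_of_tendsto hL ?_
  filter_upwards [self_mem_nhdsWithin] with t (ht : 0 < t)
  have h1 := h (x + t • v)
  rw [dist_self_add_right, norm_smul, Real.norm_of_nonneg ht.le] at h1
  rw [le_div_iff₀ ht]
  linarith

/-- The Ekeland point itself is the minimizer: otherwise its Demyanov subdifferential would contain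
an element of norm at most `σ`. -/
theorem exists_mem_Argmin_of_lt_infEDist [CompleteSpace X] {f : X → ℝ}
    (hlsc : LowerSemicontinuous f) (hbdd : BddBelow (Set.range f))
    (hqd : ∀ x, QuasidifferentiableAt f x) {σ : ℝ} (hσ : 0 < σ)
    (hlt : ENNReal.ofReal σ < Metric.infEDist (0 : StrongDual ℝ X)
      (⋃ x ∈ (Argmin f)ᶜ, demyanovSubdiff f x)) (x₀ : X) :
    ∃ x ∈ Argmin f, f x + σ * dist x₀ x ≤ f x₀ := by
  obtain ⟨x, hx, hmin⟩ := exists_ekeland_point hlsc hbdd hσ x₀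
  refine ⟨x, ?_, hx⟩
  by_contra hxA
  obtain ⟨p, q, hp, hq, hpq⟩ := hqd x
  obtain ⟨ξ, hξ, hξσ⟩ := exists_mem_clarkeSubdiff_norm_le hp hq hσ.le
    fun v => (hpq v).neg_le_of_le_add hmin
  rw [← demyanovSubdiff_eq_clarkeSubdiff hp hq hpq] at hξ
  refine hlt.not_ge ((Metric.infEDist_le_edist_of_mem (Set.mem_biUnion hxA hξ)).trans ?_)
  rw [edist_dist, dist_zero_left]
  exact ENNReal.ofReal_le_ofReal hξσ

end Normed

end WeakSharp

theorem mainTheorem1 {X : Type*} [NormedAddCommGroup X] [NormedSpace ℝ X] [CompleteSpace X]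
    (f : X → ℝ) (hlsc : LowerSemicontinuous f) (hbdd : BddBelow (Set.range f))
    (hqd : ∀ x, WeakSharp.QuasidifferentiableAt f x)
    (τ : ℝ≥0∞) (hτ : 0 < τ)
    (hdist : Metric.infEDist (0 : StrongDual ℝ X)
      (⋃ x ∈ (WeakSharp.Argmin f)ᶜ, WeakSharp.demyanovSubdiff f x) = τ) :
    WeakSharp.HasGlobalWeakSharpMinimizers f ∧ τ ≤ WeakSharp.weakSharpModulus f := by
  have key : ∀ σ : ℝ, 0 < σ → ENNReal.ofReal σ < τ →
      ∀ x₀, ∃ x ∈ WeakSharp.Argmin f, f x + σ * dist x₀ x ≤ f x₀ := fun σ hσ h =>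
    WeakSharp.exists_mem_Argmin_of_lt_infEDist hlsc hbdd hqd hσ (hdist ▸ h)
  -- Interpolating a real `σ` also covers `τ = ∞`.
  have hreal : ∀ c < τ, ∃ σ : ℝ, 0 < σ ∧ c < ENNReal.ofReal σ ∧ ENNReal.ofReal σ < τ := by
    intro c hc
    obtain ⟨r, hcr, hrτ⟩ := ENNReal.lt_iff_exists_nnreal_btwn.1 hc
    refine ⟨r, ?_, by simpa using hcr, by simpa using hrτ⟩
    exact_mod_cast (zero_le (a := c)).trans_lt hcr
  refine ⟨?_, le_of_forall_lt fun c hc => ?_⟩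
  · obtain ⟨σ, hσ, -, h⟩ := hreal 0 hτ
    obtain ⟨x, hx, -⟩ := key σ hσ h 0
    exact ⟨⟨x, hx⟩, σ, hσ, WeakSharp.isSharpConst_of_exists_mem_Argmin hσ (key σ hσ h)⟩
  · obtain ⟨σ, hσ, hcσ, h⟩ := hreal c hc
    refine hcσ.trans_le ?_
    exact le_iSup_of_le σ (le_iSup_of_le hσ (le_iSup_of_le
      (WeakSharp.isSharpConst_of_exists_mem_Argmin hσ (key σ hσ h)) le_rfl))
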